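/- Let $\mathbb{F}_q$ be a finite field with $q$ elements and let $M(x)=\sum_{i=0}^{2m}c_ix^i\in\mathbb{F}_q[x]$ be a monic polynomial of degree $2m$ with $M(0)=1$ which is self-reciprocal, i.e. $M(x)=x^{2m}M(0)^{-1}M(x^{-1})$. Suppose that $x-1$ is a factor of $M(x)$ of multiplicity exactly two, and that $M_1(x)=M(x)/(x-1)^2$ is squarefree and divisible by neither $x-1$ nor $x+1$. Put $$\Phi(x)=\sum_{i=0}^{2m}c_ix^{q^i}\in\mathbb{F}_q[x],\qquad L(x)=\Phi(x)+t\,x^{q^m}\in\mathbb{F}_q(t)[x].$$ Let $V$ be the $\mathbb{F}_q$-vector space of roots of $L$ in its splitting field over $\mathbb{F}_q(t)$, and let $G$ be the Galois group of $L$ over $\mathbb{F}_q(t)$, acting $\mathbb{F}_q$-linearly on $V$. Then $G$ is the symplectic group $Sp(2m,q)$. That is, $\dim_{\mathbb{F}_q}V=2m$, and there is a nondegenerate alternating $\mathbb{F}_q$-bilinear form $B$ on $V$ such that the action of $G$ on $V$ is faithful and its image in $GL(V)$ is exactly the group of isometries of $B$; in particular $G\cong Sp(2m,q)$, the group of $2m\times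 2m$ symplectic matrices over $\mathbb{F}_q$. -/

import Mathlib

open Polynomial

noncomputable section

namespace SymplecticGalois

/-- A polynomial `g` over a field with `g(0) ≠ 0` is self-reciprocal if it is equal to
`g^*(x) = x^d g(0)⁻¹ g(x⁻¹)`, where `d = deg g`. (`Polynomial.reverse g` is `x^d g(x⁻¹)`.) -/
def IsSelfReciprocal {F : Type*} [Field F] (g : F[X]) : Prop :=
  g.eval 0 ≠ 0 ∧ g = C (g.eval 0)⁻¹ * g.reverse

variable {F : Type*} [Field F] [Fintype F]

/-- The `q`-associate `∑ cᵢ x^(q^i)` of `M = ∑ cᵢ x^i`, where `q = |F|`. -/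
def qAssociate (M : F[X]) : F[X] :=
  M.sum fun i c => C c * X ^ (Fintype.card F ^ i)

/-- The polynomial `L = Φ + t x^(q^m)` over the rational function field `F(t)`, where `Φ` is the
`q`-associate of `M`. -/
def qPoly (m : ℕ) (M : F[X]) : (RatFunc F)[X] :=
  (qAssociate M).map (algebraMap F (RatFunc F)) +
    C (RatFunc.X : RatFunc F) * X ^ (Fintype.card F ^ m)

theorem aeval_qPoly (m : ℕ) (M : F[X]) (x : (qPoly m M).SplittingField) :
    aeval x (qPoly m M) =
      M.sum (fun i c => c • ((FiniteField.frobeniusAlgHom F _) ^ i) x) +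
        (RatFunc.X : RatFunc F) • ((FiniteField.frobeniusAlgHom F _) ^ m) x := by
  have hfrob : ∀ i : ℕ,
      ((FiniteField.frobeniusAlgHom F (qPoly m M).SplittingField) ^ i) x
        = x ^ (Fintype.card F ^ i) := by
    intro i
    rw [AlgHom.coe_pow, FiniteField.coe_frobeniusAlgHom, pow_iterate]
  have h1 : ∀ P : (RatFunc F)[X], P = qPoly m M → aeval x P =
      M.sum (fun i c => c • x ^ (Fintype.card F ^ i)) +
        (RatFunc.X : RatFunc F) • x ^ (Fintype.card F ^ m) := by
    rintro P rfl
    conv_lhs => rw [show aeval x (qPoly m M) = aeval x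
      ((qAssociate M).map (algebraMap F (RatFunc F)) +
        C (RatFunc.X : RatFunc F) * X ^ (Fintype.card F ^ m)) from rfl]
    rw [map_add, aeval_map_algebraMap, map_mul, aeval_C, map_pow, aeval_X, ← Algebra.smul_def,
      qAssociate, Polynomial.sum, map_sum, Polynomial.sum]
    congr 1
    refine Finset.sum_congr rfl fun i _ => ?_
    rw [map_mul, aeval_C, map_pow, aeval_X, ← Algebra.smul_def]
  rw [h1 _ rfl]
  simp only [hfrob]

/-- The roots of `L` in its splitting field over `F(t)`, as a vector space over `F`. -/
def rootSpace (m : ℕ) (M : F[X]) : Submodule F (qPoly m M).SplittingField where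
  carrier := {x | aeval x (qPoly m M) = 0}
  zero_mem' := by
    rw [Set.mem_ofPred_eq, aeval_qPoly]
    simp [Polynomial.sum]
  add_mem' {x y} hx hy := by
    rw [Set.mem_ofPred_eq, aeval_qPoly] at hx hy ⊢
    have h := congrArg₂ (· + ·) hx hy
    simp only [add_zero] at h
    rw [← h]
    simp only [Polynomial.sum, map_add, smul_add, Finset.sum_add_distrib]
    abel
  smul_mem' a x hx := by
    rw [Set.mem_ofPred_eq, aeval_qPoly] at hx ⊢
    have h := congrArg (a • ·) hx
    simp only [smul_zero] at h
    rw [← h, smul_add, smul_comm a (RatFunc.X : RatFunc F)]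
    simp only [Polynomial.sum, map_smul, Finset.smul_sum]
    congr 1
    exact Finset.sum_congr rfl fun i _ => smul_comm _ _ _

theorem gal_mem_rootSpace {m : ℕ} {M : F[X]} (g : (qPoly m M).Gal)
    {x : (qPoly m M).SplittingField} (hx : x ∈ rootSpace m M) : g x ∈ rootSpace m M := by
  change aeval (g x) (qPoly m M) = 0
  rw [aeval_algHom_apply g x, show aeval x (qPoly m M) = 0 from hx, map_zero]

/-- The action of the Galois group of `L` over `F(t)` on the `F`-space of roots of `L`. -/
def galRep (m : ℕ) (M : F[X]) :
    (qPoly m M).Gal →* (rootSpace m M ≃ₗ[F] rootSpace m M) where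
  toFun g :=
    { toFun := fun x => ⟨g x, gal_mem_rootSpace g x.2⟩
      invFun := fun x => ⟨g⁻¹ x, gal_mem_rootSpace g⁻¹ x.2⟩
      map_add' := fun _ _ => Subtype.ext (map_add g _ _)
      map_smul' := fun a _ => Subtype.ext (map_smul (AlgEquiv.restrictScalars F g) a _)
      left_inv := fun _ => Subtype.ext (AlgEquiv.symm_apply_apply g _)
      right_inv := fun _ => Subtype.ext (AlgEquiv.apply_symm_apply g _) }
  map_one' := rfl
  map_mul' _ _ := rfl

/-- The group of isometries of a bilinear form; for a nondegenerate alternating form on a space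
of dimension `2m` over a field with `q` elements, this is the symplectic group `Sp(2m,q)`. -/
def isometryGroup {K V : Type*} [Field K] [AddCommGroup V] [Module K V]
    (B : LinearMap.BilinForm K V) : Subgroup (V ≃ₗ[K] V) where
  carrier := {σ | ∀ u w, B (σ u) (σ w) = B u w}
  one_mem' _ _ := rfl
  mul_mem' {σ τ} hσ hτ u w := (hσ (τ u) (τ w)).trans (hτ u w)
  inv_mem' {σ} hσ u w := by
    have h := hσ (σ.symm u) (σ.symm w)
    rw [LinearEquiv.apply_symm_apply, LinearEquiv.apply_symm_apply] at h
    exact h.symm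

end SymplecticGalois

end

/-!
The action of the Galois group `G` of `L = Φ + t x^(q^m)` on its root space `V` is shown to be the
full isometry group of an explicit form, by exhibiting a transvection in `G` and using that `G` is
transitive on nonzero vectors.

*The form.* The coefficients of `M` are symmetric, so `L` is, up to a twist by the `m`-th power of
the `q`-Frobenius, a self-adjoint operator. Writing `y L(x) - x L(y)`, suitably twisted, as the
difference of a form and its Frobenius image gives an alternating form on `V` whose values are fixed
by the `q`-Frobenius, hence lie in `F` (`twistedForm_pow_card`). It is nondegenerate because `b(x, y)`
is a linearized polynomial in `y` of degree only `q^(2m-1)` (`exists_alternating_form`), and it is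
preserved by `G` because its coefficients lie in `F`.

*Transitivity.* `L / x` is linear in `t` with coprime coefficients, hence irreducible over `F(t)` by
Gauss's lemma (`irreducible_map_integralQuotient`), so `G` permutes the nonzero roots transitively.

*A transvection.* Reduction modulo a prime above `t = 0` maps `V` injectively to the zeros of `Φ`, and
`G` contains an element `σ` that reduces to the `q`-Frobenius (`exists_galRep_frobenius`). The minimal
polynomial of `σ` is therefore `M = (x - 1)² M₁`. If `M₁` divides `x^N - 1` with `N` prime to the
characteristic, then `σ^N` is not the identity, while `σ^N - 1` maps into `ker (σ - 1)`, which is a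
line (`exists_pow_sub_one_rank_one`). An isometry of this shape is a transvection.

*Conclusion.* Conjugation by a group transitive on nonzero vectors, together with the fact that every
element of a finite field is a sum of two squares, yields all symplectic transvections
(`eq_isometryGroup_of_transitive`). These generate the isometry group: a nontrivial isometry can be
multiplied by transvections so that its fixed space grows (`exists_mem_fixedSubmodule_lt`). A
symplectic basis identifies the isometry group with the matrix group.
-/

namespace SymplecticGalois

/-! ### Symplectic transvections and the generation of the isometry group -/

section Symplectic

variable {K V : Type*} [Field K] [AddCommGroup V] [Module K V]
  {B : LinearMap.BilinForm K V}

/-- The symplectic transvection `x ↦ x + a B(x, w) w`. -/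
noncomputable def sympTransvection (hB : B.IsAlt) (a : K) (w : V) : V ≃ₗ[K] V :=
  LinearEquiv.transvection (f := a • B.flip w) (v := w) (by simp [hB.self_eq_zero])

theorem sympTransvection_apply (hB : B.IsAlt) (a : K) (w x : V) :
    sympTransvection hB a w x = x + (a * B x w) • w := by
  simp [sympTransvection, LinearMap.transvection.apply]

theorem isAlt_swap (hB : B.IsAlt) (x y : V) : B x y = -B y x := by
  exact (LinearMap.BilinForm.IsAlt.neg_eq hB y x).symm

theorem sympTransvection_mem_isometryGroup (hB : B.IsAlt) (a : K) (w : V) :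
    sympTransvection hB a w ∈ isometryGroup B := by
  intro x y
  simp only [sympTransvection_apply, map_add, map_smul, LinearMap.add_apply, LinearMap.smul_apply,
    smul_eq_mul, hB.self_eq_zero]
  rw [isAlt_swap hB w y]
  ring

theorem sympTransvection_zero (hB : B.IsAlt) (w : V) : sympTransvection hB 0 w = 1 := by
  ext x; simp [sympTransvection_apply]

theorem sympTransvection_add (hB : B.IsAlt) (a b : K) (w : V) :
    sympTransvection hB (a + b) w = sympTransvection hB a w * sympTransvection hB b w := by
  ext x
  simp only [LinearEquiv.mul_apply, sympTransvection_apply, map_add, map_smul,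
    hB.self_eq_zero]
  module

theorem sympTransvection_smul (hB : B.IsAlt) (a c : K) (w : V) :
    sympTransvection hB a (c • w) = sympTransvection hB (a * c ^ 2) w := by
  ext x
  simp only [sympTransvection_apply, map_smul, smul_eq_mul]
  module

theorem sympTransvection_conj (hB : B.IsAlt) (a : K) (w : V) {g : V ≃ₗ[K] V}
    (hg : g ∈ isometryGroup B) :
    g * sympTransvection hB a w * g⁻¹ = sympTransvection hB a (g w) := by
  ext x
  have h : B x (g w) = B (g⁻¹ x) w := by
    have := hg (g⁻¹ x) w
    rwa [← LinearEquiv.mul_apply, mul_inv_cancel] at this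
  simp only [LinearEquiv.mul_apply, sympTransvection_apply, map_add, map_smul, h]
  rw [← LinearEquiv.mul_apply, mul_inv_cancel]
  rfl

/-- An isometry that differs from the identity by a map of rank one is a symplectic
transvection. -/
theorem exists_eq_sympTransvection [FiniteDimensional K V] (hB : B.IsAlt) (hnd : B.Nondegenerate)
    {g : V ≃ₗ[K] V} (hg : g ∈ isometryGroup B) (hg1 : g ≠ 1) {u : V}
    (hu : ∀ x, ∃ c : K, g x - x = c • u) :
    ∃ a : K, a ≠ 0 ∧ g = sympTransvection hB a u := by
  choose f hf using hu
  have hgx : ∀ x, g x = x + f x • u := fun x => by rw [← hf]; abel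
  have key : ∀ x y, f y * B x u = f x * B y u := by
    intro x y
    have h := hg x y
    simp only [hgx, map_add, map_smul, LinearMap.add_apply, LinearMap.smul_apply, smul_eq_mul,
      hB.self_eq_zero] at h
    rw [isAlt_swap hB u y] at h
    linear_combination h
  have hu0 : u ≠ 0 := by
    rintro rfl
    exact hg1 (by ext x; simp [hgx])
  obtain ⟨z, hz⟩ : ∃ z, B z u ≠ 0 := by
    by_contra! h
    exact hu0 (hnd.2 u h)
  have hform : g = sympTransvection hB (f z / B z u) u := by
    ext x
    rw [sympTransvection_apply, hgx, div_mul_eq_mul_div, key, mul_div_cancel_right₀ _ hz]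
  refine ⟨f z / B z u, fun h => hg1 ?_, hform⟩
  rw [hform, h, sympTransvection_zero]

/-- If `B(σ v, v) ≠ 0`, then the transvection along `σ v - v` carrying `σ v` back to `v` fixes every
vector fixed by the isometry `σ`. -/
theorem exists_transvection_fixing (hB : B.IsAlt) {σ : V ≃ₗ[K] V} (hσ : σ ∈ isometryGroup B) {v : V}
    (hv : B (σ v) v ≠ 0) :
    ∃ a w, sympTransvection hB a w (σ v) = v ∧
      ∀ x, σ x = x → sympTransvection hB a w (σ x) = x := by
  refine ⟨(B (σ v) v)⁻¹, σ v - v, ?_, fun x hx => ?_⟩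
  · rw [sympTransvection_apply]
    simp only [map_sub, hB.self_eq_zero, zero_sub, mul_neg, inv_mul_cancel₀ hv]
    module
  · have : B x (σ v - v) = 0 := by
      have := hσ x v
      rw [hx] at this
      rw [map_sub, this, sub_self]
    rw [sympTransvection_apply, hx, this, mul_zero, zero_smul, add_zero]

/-- Two nonzero linear forms have a common vector at which neither vanishes. -/
theorem exists_apply_ne_zero_and_apply_ne_zero {f g : V →ₗ[K] K} (hf : f ≠ 0) (hg : g ≠ 0) :
    ∃ x, f x ≠ 0 ∧ g x ≠ 0 := by
  obtain ⟨x, hx⟩ := DFunLike.ne_iff.1 hf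
  obtain ⟨y, hy⟩ := DFunLike.ne_iff.1 hg
  simp only [LinearMap.zero_apply] at hx hy
  by_cases h1 : g x = 0
  · by_cases h2 : f y = 0
    · exact ⟨x + y, by simpa [h2] using hx, by simpa [h1] using hy⟩
    · exact ⟨y, h2, hy⟩
  · exact ⟨x, hx, h1⟩

/-- A nontrivial isometry can be multiplied by symplectic transvections so that its space of
fixed vectors grows. -/
theorem exists_mem_fixedSubmodule_lt (hB : B.IsAlt) (hnd : B.Nondegenerate)
    {H : Subgroup (V ≃ₗ[K] V)} (hH : ∀ a w, sympTransvection hB a w ∈ H) {σ : V ≃ₗ[K] V}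
    (hσ : σ ∈ isometryGroup B)
    (hσ1 : σ ≠ 1) :
    ∃ ρ ∈ H, ρ ∈ isometryGroup B ∧
      σ.toLinearMap.fixedSubmodule < (ρ * σ).toLinearMap.fixedSubmodule := by
  -- the case where some vector is not orthogonal to its image
  have step : ∀ σ : V ≃ₗ[K] V, σ ∈ isometryGroup B → ∀ v, B (σ v) v ≠ 0 →
      ∃ ρ ∈ H, ρ ∈ isometryGroup B ∧
        σ.toLinearMap.fixedSubmodule < (ρ * σ).toLinearMap.fixedSubmodule := by
    intro σ hσ v hv
    obtain ⟨a, w, h1, h2⟩ := exists_transvection_fixing hB hσ hv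
    refine ⟨_, hH a w, sympTransvection_mem_isometryGroup hB a w, lt_of_le_of_ne ?_ fun he => ?_⟩
    · intro x hx
      exact h2 x hx
    · have : v ∈ σ.toLinearMap.fixedSubmodule := by rw [he]; exact h1
      have h3 : σ v = v := this
      rw [h3, hB.self_eq_zero] at hv
      exact hv rfl
  by_cases hv : ∃ v, B (σ v) v ≠ 0
  · obtain ⟨v, hv⟩ := hv
    exact step σ hσ v hv
  push Not at hv
  obtain ⟨v, hv1⟩ : ∃ v, σ v ≠ v := by
    by_contra! h
    exact hσ1 (by ext x; exact h x)
  -- a transvection along a vector of the image of `σ - 1` leads back to the first case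
  set w := σ v - v with hw
  have hw0 : w ≠ 0 := sub_ne_zero.2 hv1
  have hBw : B.flip w ≠ 0 := fun h => hw0 (hnd.2 w fun x => by
    simpa using congrArg (fun f => f x) h)
  have hBw' : (B.flip w).comp σ.toLinearMap ≠ 0 := fun h => hBw (by
    ext x
    have := LinearMap.congr_fun h (σ.symm x)
    simpa using this)
  obtain ⟨x, hx1, hx2⟩ := exists_apply_ne_zero_and_apply_ne_zero hBw' hBw
  simp only [LinearMap.comp_apply, LinearEquiv.coe_coe] at hx1 hx2
  have hτ : sympTransvection hB 1 w * σ ∈ isometryGroup B :=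
    mul_mem (sympTransvection_mem_isometryGroup hB 1 w) hσ
  obtain ⟨ρ, hρ, hρB, hlt⟩ := step _ hτ x (by
    rw [LinearEquiv.mul_apply, sympTransvection_apply]
    simp only [map_add, map_smul, LinearMap.add_apply, LinearMap.smul_apply, smul_eq_mul, hv,
      zero_add, one_mul]
    rw [isAlt_swap hB w x]
    exact mul_ne_zero hx1 (neg_ne_zero.2 hx2))
  refine ⟨ρ * sympTransvection hB 1 w, mul_mem hρ (hH 1 w),
    mul_mem hρB (sympTransvection_mem_isometryGroup hB 1 w), ?_⟩
  rw [mul_assoc]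
  refine lt_of_le_of_lt (fun y hy => ?_) hlt
  have hy' : σ y = y := hy
  change sympTransvection hB 1 w (σ y) = y
  have h0 : B y w = 0 := by
    have := hσ y v
    rw [hy'] at this
    rw [hw, map_sub, this, sub_self]
  rw [sympTransvection_apply, hy', h0, mul_zero, zero_smul, add_zero]

/-- The symplectic group is generated by its transvections. -/
theorem isometryGroup_le_of_sympTransvection_mem [FiniteDimensional K V] (hB : B.IsAlt)
    (hnd : B.Nondegenerate) {H : Subgroup (V ≃ₗ[K] V)}
    (hH : ∀ a w, sympTransvection hB a w ∈ H) : isometryGroup B ≤ H := by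
  suffices h : ∀ W : Submodule K V, ∀ σ ∈ isometryGroup B, σ.toLinearMap.fixedSubmodule = W →
      σ ∈ H from fun σ hσ => h _ σ hσ rfl
  intro W
  induction W using WellFoundedGT.induction with
  | ind W ih =>
    rintro σ hσ rfl
    by_cases hσ1 : σ = 1
    · rw [hσ1]; exact one_mem H
    obtain ⟨ρ, hρ, hρB, hlt⟩ := exists_mem_fixedSubmodule_lt hB hnd hH hσ hσ1
    exact (Subgroup.mul_mem_cancel_left H hρ).1 (ih _ hlt _ (mul_mem hρB hσ) rfl)

/-- In a finite field every element is a sum of two squares. -/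
theorem exists_sq_add_sq {K : Type*} [Field K] [Finite K] (c : K) :
    ∃ x y : K, x ^ 2 + y ^ 2 = c := by
  cases nonempty_fintype K
  by_cases h2 : ringChar K = 2
  · obtain ⟨x, hx⟩ := FiniteField.isSquare_of_char_two h2 c
    exact ⟨x, 0, by rw [hx]; ring⟩
  · obtain ⟨x, y, h⟩ := FiniteField.exists_root_sum_quadratic (R := K) (f := X ^ 2)
      (g := X ^ 2 - C c) (degree_X_pow 2) (degree_X_pow_sub_C (by decide) _)
      (FiniteField.odd_card_of_char_ne_two h2)
    refine ⟨x, y, ?_⟩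
    simp only [eval_pow, eval_X, eval_sub, eval_C] at h
    linear_combination h

/-- A group of isometries over a finite field that is transitive on nonzero vectors and contains
one transvection is the full symplectic group. Conjugation gives `sympTransvection a w` for all `w`
with one fixed `a`; rescaling `w` turns `a` into `a * c ^ 2`, and sums of two squares give all
multiples of `a`. -/
theorem eq_isometryGroup_of_transitive [FiniteDimensional K V] [Finite K] (hB : B.IsAlt)
    (hnd : B.Nondegenerate) {H : Subgroup (V ≃ₗ[K] V)} (hH : H ≤ isometryGroup B)
    (htrans : ∀ x y : V, x ≠ 0 → y ≠ 0 → ∃ g ∈ H, g x = y) {a : K} {u : V}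
    (ha : a ≠ 0) (hu : u ≠ 0) (hau : sympTransvection hB a u ∈ H) : H = isometryGroup B := by
  have h1 : ∀ w, sympTransvection hB a w ∈ H := by
    intro w
    by_cases hw : w = 0
    · have : sympTransvection hB a w = 1 := by
        ext x; simp [sympTransvection_apply, hw]
      rw [this]; exact one_mem H
    obtain ⟨g, hg, rfl⟩ := htrans u w hu hw
    rw [← sympTransvection_conj hB a u (hH hg)]
    exact mul_mem (mul_mem hg hau) (inv_mem hg)
  refine le_antisymm hH (isometryGroup_le_of_sympTransvection_mem hB hnd fun b w => ?_)
  obtain ⟨x, y, hxy⟩ := exists_sq_add_sq (b / a)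
  have : b = a * x ^ 2 + a * y ^ 2 := by rw [← mul_add, hxy, mul_div_cancel₀ _ ha]
  rw [this, sympTransvection_add, ← sympTransvection_smul, ← sympTransvection_smul]
  exact mul_mem (h1 _) (h1 _)

end Symplectic

/-! ### Symplectic bases -/

section SymplecticBasis

open Module

/-- A nondegenerate alternating form on a space of dimension `2m` has hyperbolic pairs `u i, v i`
that are mutually orthogonal. -/
theorem exists_symplectic_family {K : Type*} [Field K] (m : ℕ) :
    ∀ {V : Type*} [AddCommGroup V] [Module K V] [FiniteDimensional K V]
      {B : LinearMap.BilinForm K V}, B.IsAlt → B.Nondegenerate → finrank K V = 2 * m →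
      ∃ u v : Fin m → V, (∀ i j, B (u i) (u j) = 0) ∧ (∀ i j, B (v i) (v j) = 0) ∧
        ∀ i j, B (u i) (v j) = if i = j then 1 else 0 := by
  induction m with
  | zero =>
    intro V _ _ _ B _ _ _
    exact ⟨0, 0, fun i => i.elim0, fun i => i.elim0, fun i => i.elim0⟩
  | succ m ih =>
    intro V _ _ _ B hB hnd hV
    have : Nontrivial V := nontrivial_of_finrank_pos (R := K) (by lia)
    obtain ⟨x, hx⟩ := exists_ne (0 : V)
    obtain ⟨y, hxy⟩ : ∃ y, B x y = 1 := by
      obtain ⟨z, hz⟩ : ∃ z, B x z ≠ 0 := by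
        by_contra! h
        exact hx (hnd.1 x h)
      exact ⟨(B x z)⁻¹ • z, by simp [hz]⟩
    have hyx : B y x = -1 := by rw [isAlt_swap hB, hxy]
    have hcoef : ∀ a b : K, B x (a • x + b • y) = b ∧ B y (a • x + b • y) = -a := by
      intro a b
      simp [hB.self_eq_zero, hxy, hyx]
    -- split off the hyperbolic plane `W` spanned by `x, y` and pass to its orthogonal complement
    set W : Submodule K V := Submodule.span K (Set.range ![x, y]) with hW
    have hli : LinearIndependent K ![x, y] := by
      rw [LinearIndependent.pair_iff]
      intro a b h
      obtain ⟨h1, h2⟩ := hcoef a b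
      rw [h, map_zero] at h1 h2
      exact ⟨neg_eq_zero.1 h2.symm, h1.symm⟩
    have hWrank : finrank K W = 2 := by
      rw [hW, finrank_span_eq_card hli, Fintype.card_fin]
    have hxW : x ∈ W := Submodule.subset_span ⟨0, rfl⟩
    have hyW : y ∈ W := Submodule.subset_span ⟨1, rfl⟩
    have hdisj : Disjoint W (B.orthogonal W) := by
      rw [Submodule.disjoint_def]
      intro z hz hz'
      rw [hW, Matrix.range_cons, Matrix.range_cons, Matrix.range_empty, Set.union_empty,
        ← Set.insert_eq, Submodule.mem_span_pair] at hz
      obtain ⟨a, b, rfl⟩ := hz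
      obtain ⟨h1, h2⟩ := hcoef a b
      have hb : b = 0 := h1.symm.trans (hz' x hxW)
      have ha : a = 0 := neg_eq_zero.1 (h2.symm.trans (hz' y hyW))
      simp [ha, hb]
    obtain ⟨u, v, h1, h2, h3⟩ := ih (V := B.orthogonal W) (B := B.restrict (B.orthogonal W))
      (fun z => hB z)
      (B.nondegenerate_restrict_of_disjoint_orthogonal hB.isRefl
        (by rw [LinearMap.BilinForm.orthogonal_orthogonal hnd hB.isRefl]; exact hdisj.symm))
      (by rw [LinearMap.BilinForm.finrank_orthogonal hnd, hV, hWrank]; lia)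
    have hxo : ∀ z : B.orthogonal W, B x z = 0 ∧ B z x = 0 := fun z =>
      ⟨z.2 x hxW, by rw [isAlt_swap hB, show B x z = 0 from z.2 x hxW, neg_zero]⟩
    have hyo : ∀ z : B.orthogonal W, B y z = 0 ∧ B z y = 0 := fun z =>
      ⟨z.2 y hyW, by rw [isAlt_swap hB, show B y z = 0 from z.2 y hyW, neg_zero]⟩
    simp only [LinearMap.BilinForm.restrict_apply, LinearMap.domRestrict_apply] at h1 h2 h3
    refine ⟨Fin.cons x fun i => u i, Fin.cons y fun i => v i, ?_, ?_, ?_⟩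
    · intro i j
      refine Fin.cases ?_ (fun i => ?_) i <;> refine Fin.cases ?_ (fun j => ?_) j <;>
        simp [hB.self_eq_zero, hxo, h1]
    · intro i j
      refine Fin.cases ?_ (fun i => ?_) i <;> refine Fin.cases ?_ (fun j => ?_) j <;>
        simp [hB.self_eq_zero, hyo, h2]
    · intro i j
      refine Fin.cases ?_ (fun i => ?_) i <;> refine Fin.cases ?_ (fun j => ?_) j <;>
        simp [hxy, hxo, hyo, h3, (Fin.succ_ne_zero _).symm]

/-- A nondegenerate alternating form on a space of dimension `2m` has Gram matrix `Matrix.J` in a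
suitable basis. -/
theorem exists_basis_toMatrix_eq_J {K V : Type*} [Field K] [AddCommGroup V] [Module K V]
    [FiniteDimensional K V] {m : ℕ} {B : LinearMap.BilinForm K V} (hB : B.IsAlt)
    (hnd : B.Nondegenerate) (hV : finrank K V = 2 * m) :
    ∃ b : Basis (Fin m ⊕ Fin m) K V, LinearMap.BilinForm.toMatrix b B = Matrix.J (Fin m) K := by
  obtain ⟨u, v, h1, h2, h3⟩ := exists_symplectic_family m hB hnd hV
  have h4 : ∀ i j, B (v i) (u j) = if i = j then -1 else 0 := by
    intro i j
    rw [isAlt_swap hB, h3]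
    by_cases h : i = j <;> simp [h, eq_comm]
  -- `Matrix.J` has the block `-1` in the upper right corner, so the pairs are ordered `v, u`
  have hli : LinearIndependent K (Sum.elim v u) := by
    rw [Fintype.linearIndependent_iff]
    intro c hc
    simp only [Fintype.sum_sum_type, Sum.elim_inl, Sum.elim_inr] at hc
    rintro (i | i)
    · have := congrArg (B (u i)) hc
      simpa [map_sum, h1, h3] using this
    · have := congrArg (B (v i)) hc
      simpa [map_sum, h2, h4] using this
  refine ⟨basisOfLinearIndependentOfCardEqFinrank' _ hli (by simp [hV, two_mul]), ?_⟩
  ext (i | i) (j | j) <;>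
    simp [LinearMap.BilinForm.toMatrix_apply, Matrix.J, h1, h2, h3, h4, Matrix.one_apply,
      Matrix.neg_apply]
  split_ifs <;> simp

/-- The isometry group of a nondegenerate alternating form in dimension `2m` is the matrix
symplectic group. -/
theorem nonempty_isometryGroup_mulEquiv {K V : Type*} [Field K] [AddCommGroup V] [Module K V]
    [FiniteDimensional K V] {m : ℕ} {B : LinearMap.BilinForm K V} (hB : B.IsAlt)
    (hnd : B.Nondegenerate) (hV : finrank K V = 2 * m) :
    Nonempty (isometryGroup B ≃* Matrix.symplecticGroup (Fin m) K) := by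
  obtain ⟨b, hb⟩ := exists_basis_toMatrix_eq_J hB hnd hV
  have hiff : ∀ f : V →ₗ[K] V, LinearMap.toMatrix b b f ∈ Matrix.symplecticGroup (Fin m) K ↔
      ∀ x y, B (f x) (f y) = B x y := by
    intro f
    rw [SymplecticGroup.mem_iff', ← hb, ← LinearMap.BilinForm.toMatrix_comp (b := b) (c := b),
      (LinearMap.BilinForm.toMatrix b).injective.eq_iff]
    exact ⟨fun h x y => LinearMap.congr_fun₂ h x y, fun h => LinearMap.ext₂ h⟩
  let φ : isometryGroup B →* Matrix.symplecticGroup (Fin m) K :=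
    { toFun := fun σ => ⟨LinearMap.toMatrix b b σ.1.toLinearMap, (hiff _).2 σ.2⟩
      map_one' := Subtype.ext (LinearMap.toMatrix_one b)
      map_mul' := fun σ τ =>
        Subtype.ext (LinearMap.toMatrix_mul b σ.1.toLinearMap τ.1.toLinearMap) }
  refine ⟨MulEquiv.ofBijective φ ⟨fun σ τ h => ?_, fun A => ?_⟩⟩
  · have h' : LinearMap.toMatrix b b σ.1.toLinearMap = LinearMap.toMatrix b b τ.1.toLinearMap :=
      congrArg Subtype.val h
    exact Subtype.ext (LinearEquiv.toLinearMap_injective ((LinearMap.toMatrix b b).injective h'))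
  · set f : V →ₗ[K] V := Matrix.toLin b b A.1 with hf
    have hfA : LinearMap.toMatrix b b f = A.1 := LinearMap.toMatrix_toLin b b A.1
    have hfB := (hiff f).1 (hfA ▸ A.2)
    have hinj : Function.Injective f := by
      rw [injective_iff_map_eq_zero]
      intro x hx
      refine hnd.1 x fun y => ?_
      rw [← hfB, hx, map_zero, LinearMap.zero_apply]
    exact ⟨⟨LinearEquiv.ofInjectiveEndo f hinj, hfB⟩, Subtype.ext hfA⟩

end SymplecticBasis

/-! ### Linearized polynomials -/

section Linearized

variable {K : Type*} [Field K]

/-- The linearized polynomial `∑ cᵢ x^(q^i)` attached to `P = ∑ cᵢ x^i`, over an arbitrary field of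
coefficients, as a linear function of `P`. -/
noncomputable def linearized (q : ℕ) : K[X] →ₗ[K] K[X] :=
  lsum fun i => LinearMap.toSpanSingleton K K[X] (X ^ q ^ i)

theorem linearized_eq_sum (q : ℕ) (P : K[X]) :
    linearized q P = P.sum fun i c => C c * X ^ q ^ i := by
  simp [linearized, smul_eq_C_mul, Polynomial.sum]

theorem eval_linearized (q : ℕ) (P : K[X]) (y : K) :
    (linearized q P).eval y = P.sum fun i c => c * y ^ q ^ i := by
  simp [linearized_eq_sum, Polynomial.sum, eval_finsetSum]

theorem linearized_C_mul_X_pow (q : ℕ) (c : K) (i : ℕ) :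
    linearized q (C c * X ^ i) = C c * X ^ q ^ i := by
  rw [linearized_eq_sum, C_mul_X_pow_eq_monomial, sum_monomial_index _ _ (by simp)]

theorem coeff_linearized {q : ℕ} (hq : 1 < q) (P : K[X]) (i : ℕ) :
    (linearized q P).coeff (q ^ i) = P.coeff i := by
  simp only [linearized_eq_sum, Polynomial.sum, finsetSum_coeff, coeff_C_mul, coeff_X_pow,
    Nat.pow_right_inj hq, mul_ite, mul_one, mul_zero]
  rw [Finset.sum_ite_eq, ite_eq_left_iff, notMem_support_iff]
  exact Eq.symm

theorem natDegree_linearized {q : ℕ} (hq : 1 < q) {P : K[X]} (hP : P ≠ 0) :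
    (linearized q P).natDegree = q ^ P.natDegree := by
  refine le_antisymm ?_ (le_natDegree_of_ne_zero ?_)
  · rw [linearized_eq_sum]
    refine natDegree_sum_le_of_forall_le _ _ fun i hi => ?_
    refine (natDegree_C_mul_X_pow_le _ _).trans ?_
    exact Nat.pow_le_pow_right (by lia) (le_natDegree_of_mem_supp i hi)
  · rw [coeff_linearized hq]
    exact leadingCoeff_ne_zero.2 hP

theorem linearized_ne_zero {q : ℕ} (hq : 1 < q) {P : K[X]} (hP : P ≠ 0) : linearized q P ≠ 0 := by
  intro h
  have := natDegree_linearized hq hP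
  rw [h, natDegree_zero] at this
  exact absurd this.symm (pow_ne_zero _ (by lia))

/-- The counting principle used throughout: a linearized polynomial of `q`-degree less than `n`
with `q ^ n` zeros vanishes identically. -/
theorem eq_zero_of_eval_linearized {q n : ℕ} (hq : 1 < q) {P : K[X]} (hP : P.degree < n)
    {s : Set K} (hs : q ^ n ≤ s.ncard) (h : ∀ y ∈ s, (linearized q P).eval y = 0) : P = 0 := by
  by_contra hP0
  classical
  have hsub : s ⊆ (linearized q P).roots.toFinset := fun y hy => by
    simp only [Finset.mem_coe, Multiset.mem_toFinset, mem_roots (linearized_ne_zero hq hP0)]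
    exact h y hy
  have h1 := Set.ncard_le_ncard hsub (Finset.finite_toSet _)
  rw [Set.ncard_coe_finset] at h1
  have h2 := (Multiset.toFinset_card_le _).trans (card_roots' (linearized q P))
  rw [natDegree_linearized hq hP0] at h2
  have h3 : q ^ P.natDegree < q ^ n :=
    Nat.pow_lt_pow_right hq ((natDegree_lt_iff_degree_lt hP0).2 hP)
  lia

theorem separable_linearized {q : ℕ} (hq0 : (q : K) = 0) {P : K[X]} (hP : P.coeff 0 ≠ 0) :
    (linearized q P).Separable := by
  have hd : derivative (linearized q P) = C (P.coeff 0) := by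
    simp only [linearized_eq_sum, Polynomial.sum, derivative_sum, derivative_C_mul,
      derivative_X_pow]
    rw [Finset.sum_eq_single 0]
    · simp
    · intro i _ hi
      rw [Nat.cast_pow, hq0, zero_pow hi]
      simp
    · intro h0
      simp [notMem_support_iff.1 h0]
  rw [separable_def, hd]
  exact ⟨0, C (P.coeff 0)⁻¹, by rw [zero_mul, zero_add, ← C_mul, inv_mul_cancel₀ hP, C_1]⟩

end Linearized

/-! ### The invariant alternating form -/

section Form

variable {F : Type*} [Field F] [Fintype F] {E : Type*} [Field E] [Algebra F E]

theorem frobeniusAlgHom_pow_apply (i : ℕ) (x : E) :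
    (FiniteField.frobeniusAlgHom F E ^ i) x = x ^ Fintype.card F ^ i := by
  rw [AlgHom.coe_pow, FiniteField.coe_frobeniusAlgHom, pow_iterate]

/-- The elements fixed by the `q`-Frobenius are those of `F`, as `x ^ q - x` has at most `q`
roots. -/
theorem exists_algebraMap_eq_of_pow_card_eq {x : E} (hx : x ^ Fintype.card F = x) :
    ∃ c : F, algebraMap F E c = x := by
  classical
  by_contra! hne
  have hq : 1 < Fintype.card F := Fintype.one_lt_card
  have hsub : (insert x (Finset.univ.image (algebraMap F E))).val ⊆
      (X ^ Fintype.card F - X : E[X]).roots := by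
    intro y hy
    rw [mem_roots (FiniteField.X_pow_card_sub_X_ne_zero E hq), IsRoot.def]
    rw [Finset.mem_val, Finset.mem_insert, Finset.mem_image] at hy
    obtain rfl | ⟨a, -, rfl⟩ := hy
    · simp [hx]
    · simp [← map_pow, FiniteField.pow_card]
  have h := card_le_degree_of_subset_roots hsub
  rw [FiniteField.X_pow_card_sub_X_natDegree_eq E hq, Finset.card_insert_of_notMem,
    Finset.card_image_of_injective _ (algebraMap F E).injective, Finset.card_univ] at h
  · lia
  · simpa using hne

variable (E) in
/-- The alternating form
`b(x, y) = ∑_{1 ≤ j ≤ m} c_{m+j} ∑_{k < j} (x^(m+k) y^(m+k-j) - y^(m+k) x^(m+k-j))`, where `z^(i)`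
stands for `z ^ q ^ i`. The outer index is shifted by one in the definition; since it stays at most
`m`, the subtraction in `m + k - (j + 1)` does not truncate. -/
noncomputable def twistedForm (m : ℕ) (c : ℕ → F) : E →ₗ[F] E →ₗ[F] E :=
  let τ : ℕ → E →ₗ[F] E := fun i => (FiniteField.frobeniusAlgHom F E ^ i).toLinearMap
  ∑ j ∈ Finset.range m, c (m + (j + 1)) • ∑ k ∈ Finset.range (j + 1),
    ((LinearMap.mul F E).compl₁₂ (τ (m + k)) (τ (m + k - (j + 1))) -
      ((LinearMap.mul F E).compl₁₂ (τ (m + k)) (τ (m + k - (j + 1)))).flip)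

theorem twistedForm_apply (m : ℕ) (c : ℕ → F) (x y : E) :
    twistedForm E m c x y = ∑ j ∈ Finset.range m, c (m + (j + 1)) • ∑ k ∈ Finset.range (j + 1),
      (x ^ Fintype.card F ^ (m + k) * y ^ Fintype.card F ^ (m + k - (j + 1)) -
        y ^ Fintype.card F ^ (m + k) * x ^ Fintype.card F ^ (m + k - (j + 1))) := by
  simp [twistedForm, LinearMap.sum_apply, frobeniusAlgHom_pow_apply]

theorem twistedForm_self (m : ℕ) (c : ℕ → F) (x : E) : twistedForm E m c x x = 0 := by
  simp [twistedForm_apply]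

/-- The form commutes with `F`-algebra homomorphisms, since its coefficients lie in `F`. -/
theorem map_twistedForm (m : ℕ) (c : ℕ → F) (g : E →ₐ[F] E) (x y : E) :
    g (twistedForm E m c x y) = twistedForm E m c (g x) (g y) := by
  simp [twistedForm_apply]

/-- For symmetric coefficients the linearized operator is a sum over pairs `m + j`, `m - j`. -/
theorem sum_range_symmetric {F : Type*} [Field F] {E : Type*} [Field E] [Algebra F E] {m : ℕ}
    {c : ℕ → F} (hc : ∀ i ≤ 2 * m, c (2 * m - i) = c i) (f : ℕ → E) :
    ∑ i ∈ Finset.range (2 * m + 1), c i • f i =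
      ∑ j ∈ Finset.range m, c (m + (j + 1)) • (f (m + (j + 1)) + f (m - (j + 1))) + c m • f m := by
  rw [show 2 * m + 1 = m + (m + 1) by lia, Finset.sum_range_add, Finset.sum_range_succ',
    ← Finset.sum_range_reflect, add_zero, ← add_assoc, ← Finset.sum_add_distrib]
  congr 1
  refine Finset.sum_congr rfl fun j hj => ?_
  have hj' := Finset.mem_range.1 hj
  rw [show m - 1 - j = m - (j + 1) by lia, ← hc (m - (j + 1)) (by lia),
    show 2 * m - (m - (j + 1)) = m + (j + 1) by lia, smul_add, add_comm]

/-- Self-adjointness of the operator makes `b(x, y)` invariant under the `q`-Frobenius when `x` and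
`y` are zeros of it: the difference telescopes to `y^(m) L(x) - x^(m) L(y)`. -/
theorem twistedForm_pow_card {m : ℕ} {c : ℕ → F} (hc : ∀ i ≤ 2 * m, c (2 * m - i) = c i) {T x y : E}
    (hx : ∑ i ∈ Finset.range (2 * m + 1), c i • x ^ Fintype.card F ^ i +
      T * x ^ Fintype.card F ^ m = 0)
    (hy : ∑ i ∈ Finset.range (2 * m + 1), c i • y ^ Fintype.card F ^ i +
      T * y ^ Fintype.card F ^ m = 0) :
    twistedForm E m c x y ^ Fintype.card F = twistedForm E m c x y := by
  set q := Fintype.card F with hq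
  rw [sum_range_symmetric hc] at hx hy
  have hτ : twistedForm E m c x y ^ q = twistedForm E m c (x ^ q) (y ^ q) :=
    map_twistedForm m c (FiniteField.frobeniusAlgHom F E) x y
  rw [hτ, ← sub_eq_zero, twistedForm_apply, twistedForm_apply, ← Finset.sum_sub_distrib]
  have hterm : ∀ j ∈ Finset.range m,
      (c (m + (j + 1)) • ∑ k ∈ Finset.range (j + 1),
        ((x ^ q) ^ q ^ (m + k) * (y ^ q) ^ q ^ (m + k - (j + 1)) -
          (y ^ q) ^ q ^ (m + k) * (x ^ q) ^ q ^ (m + k - (j + 1))) -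
      c (m + (j + 1)) • ∑ k ∈ Finset.range (j + 1),
        (x ^ q ^ (m + k) * y ^ q ^ (m + k - (j + 1)) -
          y ^ q ^ (m + k) * x ^ q ^ (m + k - (j + 1)))) =
      y ^ q ^ m * (c (m + (j + 1)) • (x ^ q ^ (m + (j + 1)) + x ^ q ^ (m - (j + 1)))) -
      x ^ q ^ m * (c (m + (j + 1)) • (y ^ q ^ (m + (j + 1)) + y ^ q ^ (m - (j + 1)))) := by
    intro j hj
    have hj' := Finset.mem_range.1 hj
    rw [← smul_sub, ← Finset.sum_sub_distrib]
    have htel := Finset.sum_range_sub (fun k => x ^ q ^ (m + k) * y ^ q ^ (m + k - (j + 1)) -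
      y ^ q ^ (m + k) * x ^ q ^ (m + k - (j + 1))) (j + 1)
    -- the Frobenius raises every exponent by one, that is, it shifts `k`
    rw [Finset.sum_congr rfl (g := fun k => _ - _) fun k _ => ?_, htel]
    rotate_left
    · simp only [← pow_mul, ← pow_succ']
      rw [show m + k - (j + 1) + 1 = m + (k + 1) - (j + 1) by lia, add_assoc m k 1]
    simp only [add_zero, Nat.add_sub_cancel]
    simp only [Algebra.smul_def]
    ring
  rw [Finset.sum_congr rfl hterm, Finset.sum_sub_distrib, ← Finset.mul_sum, ← Finset.mul_sum]
  simp only [Algebra.smul_def] at hx hy ⊢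
  linear_combination y ^ q ^ m * hx - x ^ q ^ m * hy

/-- The linearized polynomial in `y` underlying `b(x, y)`. -/
noncomputable def twistedFormPoly (m : ℕ) (c : ℕ → F) (x : E) : E[X] :=
  ∑ j ∈ Finset.range m, c (m + (j + 1)) • ∑ k ∈ Finset.range (j + 1),
    (C (x ^ Fintype.card F ^ (m + k)) * X ^ (m + k - (j + 1)) -
      C (x ^ Fintype.card F ^ (m + k - (j + 1))) * X ^ (m + k))

theorem eval_linearized_twistedFormPoly (m : ℕ) (c : ℕ → F) (x y : E) :
    (linearized (Fintype.card F) (twistedFormPoly m c x)).eval y = twistedForm E m c x y := by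
  rw [twistedForm_apply, twistedFormPoly]
  simp only [map_sum, LinearMap.map_smul_of_tower, map_sub, linearized_C_mul_X_pow, eval_finsetSum,
    eval_smul, eval_sub, eval_mul, eval_C, eval_pow, eval_X]
  simp only [mul_comm (x ^ Fintype.card F ^ (m + _ - _)) _]

theorem degree_twistedFormPoly_lt {m : ℕ} (c : ℕ → F) (x : E) :
    (twistedFormPoly m c x).degree < (2 * m : ℕ) := by
  rw [← mem_degreeLT]
  refine sum_mem fun j hj => Submodule.smul_of_tower_mem _ _ (sum_mem fun k hk => sub_mem ?_ ?_)
  all_goals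
    rw [mem_degreeLT]
    refine (degree_C_mul_X_pow_le _ _).trans_lt ?_
    have := Finset.mem_range.1 hj
    have := Finset.mem_range.1 hk
    exact_mod_cast (by lia)

/-- Only the term with the largest values of both `j` and `k` contributes to the top coefficient. -/
theorem coeff_twistedFormPoly {m : ℕ} (c : ℕ → F) (x : E) :
    (twistedFormPoly (m + 1) c x).coeff (2 * m + 1) =
      -(c (2 * (m + 1)) • x ^ Fintype.card F ^ m) := by
  simp only [twistedFormPoly, finsetSum_coeff, coeff_smul, coeff_sub, coeff_C_mul, coeff_X_pow]
  rw [Finset.sum_eq_single m, Finset.sum_eq_single m]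
  · rw [if_neg (by lia), if_pos (by lia), show m + 1 + m - (m + 1) = m by lia,
      show m + 1 + (m + 1) = 2 * (m + 1) by lia]
    simp
  · intro k hk hkm
    have := Finset.mem_range.1 hk
    rw [if_neg (by lia), if_neg (by lia)]
    simp
  · intro h; simp at h
  · intro j hj hjm
    have := Finset.mem_range.1 hj
    rw [Finset.sum_eq_zero, smul_zero]
    intro k hk
    have := Finset.mem_range.1 hk
    rw [if_neg (by lia), if_neg (by lia)]
    simp
  · intro h; simp at h

/-- On a space `V` of `q ^ (2m)` zeros of the self-adjoint operator
`∑ cᵢ x^(q^i) + T x^(q^m)` the values of `twistedForm` lie in `F` and make up a nondegenerate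
alternating form: a vector `x` in the radical would give a linearized polynomial in `y` of `q`-degree
less than `2m` that vanishes on `V`. -/
theorem exists_alternating_form {m : ℕ} (hm : m ≠ 0) {c : ℕ → F}
    (hc : ∀ i ≤ 2 * m, c (2 * m - i) = c i) (hc0 : c (2 * m) ≠ 0) {T : E} (V : Submodule F E)
    (hV : ∀ x ∈ V, ∑ i ∈ Finset.range (2 * m + 1), c i • x ^ Fintype.card F ^ i +
      T * x ^ Fintype.card F ^ m = 0)
    (hcard : Fintype.card F ^ (2 * m) ≤ (V : Set E).ncard) :
    ∃ B : LinearMap.BilinForm F V, B.IsAlt ∧ B.Nondegenerate ∧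
      ∀ x y : V, algebraMap F E (B x y) = twistedForm E m c x y := by
  have hex : ∀ x y : V, ∃ b : F, algebraMap F E b = twistedForm E m c x y := fun x y =>
    exists_algebraMap_eq_of_pow_card_eq (twistedForm_pow_card hc (hV x x.2) (hV y y.2))
  choose b hb using hex
  have hinj := (algebraMap F E).injective
  let B : LinearMap.BilinForm F V := LinearMap.mk₂ F b
    (fun x y z => hinj (by simp [hb]))
    (fun a x y => hinj (by
      rw [hb, Submodule.coe_smul, map_smul, LinearMap.smul_apply, smul_eq_mul, map_mul, hb,
        Algebra.smul_def]))
    (fun x y z => hinj (by simp [hb]))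
    (fun a x y => hinj (by
      rw [hb, Submodule.coe_smul, map_smul, smul_eq_mul, map_mul, hb, Algebra.smul_def]))
  have hB : ∀ x y : V, algebraMap F E (B x y) = twistedForm E m c x y := hb
  have halt : B.IsAlt := fun x => hinj (by rw [hB, twistedForm_self, map_zero])
  refine ⟨B, halt, ?_, hB⟩
  refine halt.isRefl.nondegenerate_iff_separatingLeft.2 fun x hx => ?_
  have hP : twistedFormPoly m c (x : E) = 0 :=
    eq_zero_of_eval_linearized Fintype.one_lt_card (degree_twistedFormPoly_lt c (x : E)) hcard
      fun y hy => by
        rw [eval_linearized_twistedFormPoly, ← hB x ⟨y, hy⟩, hx, map_zero]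
  obtain ⟨n, rfl⟩ := Nat.exists_eq_succ_of_ne_zero hm
  have h := coeff_twistedFormPoly (m := n) c (x : E)
  rw [← Nat.succ_eq_add_one n, hP, coeff_zero, eq_comm, neg_eq_zero, smul_eq_zero] at h
  exact Subtype.ext (eq_zero_of_pow_eq_zero (h.resolve_left hc0))

end Form

/-! ### A transvection as a power of a Frobenius element -/

section FrobeniusPower

variable {F : Type*} [Field F]

/-- A squarefree polynomial over a finite field with nonzero constant term divides `X ^ N - 1` for
some `N` prime to the characteristic. -/
theorem exists_dvd_X_pow_sub_one [Finite F] {P : F[X]} (hP : Squarefree P) (h0 : P.eval 0 ≠ 0) :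
    ∃ N : ℕ, (N : F) ≠ 0 ∧ P ∣ X ^ N - 1 := by
  have hP0 : P ≠ 0 := hP.ne_zero
  -- some power of `X` is congruent to one, as the quotient ring is finite
  obtain ⟨n, hn, hdvd⟩ : ∃ n : ℕ, n ≠ 0 ∧ P ∣ X ^ n - 1 := by
    have : Module.Finite F (AdjoinRoot P) := (AdjoinRoot.powerBasis hP0).finite
    have : Finite (AdjoinRoot P) := Module.finite_of_finite F
    have hcop : IsCoprime (X : F[X]) P :=
      irreducible_X.coprime_iff_not_dvd.2 fun h => h0 (by
        rwa [X_dvd_iff, coeff_zero_eq_eval_zero] at h)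
    obtain ⟨a, b, hab⟩ := hcop
    have hunit : AdjoinRoot.mk P a * AdjoinRoot.mk P X = 1 := by
      rw [← map_mul, ← map_one (AdjoinRoot.mk P), ← hab, map_add, map_mul (AdjoinRoot.mk P) b P,
        AdjoinRoot.mk_self, mul_zero, add_zero]
    obtain ⟨n, hn, h⟩ := isOfFinOrder_iff_pow_eq_one.1
      (isOfFinOrder_of_finite (Units.mkOfMulEqOne _ _ ((mul_comm _ _).trans hunit)))
    refine ⟨n, hn.ne', ?_⟩
    rw [← AdjoinRoot.mk_eq_zero, map_sub, map_pow, map_one, sub_eq_zero]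
    simpa using congrArg Units.val h
  obtain ⟨p, hp⟩ := CharP.exists F
  have hprime : p.Prime := CharP.char_is_prime F p
  have : Fact p.Prime := ⟨hprime⟩
  obtain ⟨k, N, hN, rfl⟩ := Nat.exists_eq_pow_mul_and_not_dvd hn p hprime.ne_one
  refine ⟨N, fun h => hN ((CharP.cast_eq_zero_iff F p N).1 h), ?_⟩
  have hpow : (X : F[X]) ^ (p ^ k * N) - 1 = (X ^ N - 1) ^ p ^ k := by
    rw [sub_pow_char_pow, one_pow, ← pow_mul, mul_comm]
  rw [hpow] at hdvd
  exact (hP.dvd_pow_iff_dvd (pow_ne_zero _ hprime.ne_zero)).1 hdvd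

variable [Fintype F] {V k : Type*} [AddCommGroup V] [Module F V] [Field k] [Algebra F k]

/-- If `σ` is the `q`-Frobenius on the image of `V` under `ρ`, then a polynomial in `σ` acts through
its linearized polynomial. -/
theorem apply_aeval_eq_eval_linearized {σ : V →ₗ[F] V} {ρ : V →ₗ[F] k}
    (h : ∀ v, ρ (σ v) = ρ v ^ Fintype.card F) (P : F[X]) (v : V) :
    ρ (aeval σ P v) = (linearized (Fintype.card F) (P.map (algebraMap F k))).eval (ρ v) := by
  have hpow : ∀ i : ℕ, ρ ((σ ^ i) v) = ρ v ^ Fintype.card F ^ i := by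
    intro i
    induction i with
    | zero => simp
    | succ i ih => rw [pow_succ', Module.End.mul_apply, h, ih, ← pow_mul, ← pow_succ]
  induction P using Polynomial.induction_on' with
  | add P Q hP hQ => simp [hP, hQ]
  | monomial i a =>
    rw [map_monomial, ← C_mul_X_pow_eq_monomial, ← C_mul_X_pow_eq_monomial, linearized_C_mul_X_pow]
    simp [hpow, Algebra.smul_def]

/-- Suppose that `V` has `q ^ deg M` elements, that `σ` is the `q`-Frobenius on a faithful image of
`V`, and that `M(σ) = 0`, where `M = (X - 1)² M₁` with `M₁` squarefree and prime to `X (X - 1)`. Then a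
power of `σ` differs from the identity by a map of rank one. Indeed `M` is the minimal polynomial of
`σ`, so that the power `σ ^ N` with `M₁ ∣ X ^ N - 1` is not the identity, and `σ ^ N - 1` maps into
the kernel of `σ - 1`, which is a line because the elements fixed by the `q`-Frobenius are those of
`F`. -/
theorem exists_pow_sub_one_rank_one {σ : V →ₗ[F] V} {ρ : V →ₗ[F] k} (hρ : Function.Injective ρ)
    (h : ∀ v, ρ (σ v) = ρ v ^ Fintype.card F) {M M₁ : F[X]} (hM : M.Monic)
    (hcard : Fintype.card F ^ M.natDegree ≤ Nat.card V) (hMσ : aeval σ M = 0)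
    (hM₁ : M = (X - C 1) ^ 2 * M₁) (hsq : Squarefree M₁) (h0 : M₁.eval 0 ≠ 0)
    (hsub : ¬ (X - C 1) ∣ M₁) :
    ∃ N : ℕ, σ ^ N ≠ 1 ∧ ∃ u : V, u ≠ 0 ∧ ∀ v, ∃ c : F, (σ ^ N) v - v = c • u := by
  have hmin : ∀ P : F[X], aeval σ P = 0 → M ∣ P := by
    intro P hP
    rw [← modByMonic_eq_zero_iff_dvd hM]
    have hR : aeval σ (P %ₘ M) = 0 := by
      have := congrArg (aeval σ) (modByMonic_add_div P M)
      rwa [map_add, map_mul, hMσ, zero_mul, add_zero, hP] at this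
    refine (Polynomial.map_eq_zero (algebraMap F k)).1 (eq_zero_of_eval_linearized
      (n := M.natDegree) (s := Set.range ρ) (Fintype.one_lt_card (α := F)) ?_ ?_ ?_)
    · rw [degree_map, ← degree_eq_natDegree hM.ne_zero]
      exact degree_modByMonic_lt _ hM
    · rwa [← Set.image_univ, Set.ncard_image_of_injective _ hρ, Set.ncard_univ]
    · rintro _ ⟨v, rfl⟩
      rw [← apply_aeval_eq_eval_linearized h, hR, LinearMap.zero_apply, map_zero]
  obtain ⟨N, hN, hdvd⟩ := exists_dvd_X_pow_sub_one hsq h0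
  have hN1 : σ ^ N ≠ 1 := by
    intro hσN
    have h1 : M ∣ X ^ N - C 1 := hmin _ (by simp [hσN])
    have h2 : (X - C (1 : F)) * (X - C 1) ∣ X ^ N - C 1 := by
      rw [← sq]; exact (hM₁ ▸ dvd_mul_right _ _ : (X - C (1 : F)) ^ 2 ∣ M).trans h1
    exact not_isUnit_X_sub_C _ ((separable_X_pow_sub_C (1 : F) hN one_ne_zero).squarefree _ h2)
  refine ⟨N, hN1, ?_⟩
  have hfix : ∀ v, σ ((σ ^ N) v - v) = (σ ^ N) v - v := by
    obtain ⟨W, hW⟩ : (X - C 1) * M₁ ∣ X ^ N - 1 := by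
      refine IsCoprime.mul_dvd ((irreducible_X_sub_C (1 : F)).coprime_iff_not_dvd.2 hsub) ?_ hdvd
      rw [dvd_iff_isRoot]
      simp
    have hz : aeval σ ((X - 1 : F[X]) * (X ^ N - 1)) = 0 := by
      have : (X - 1 : F[X]) * (X ^ N - 1) = M * W := by rw [hW, hM₁, C_1]; ring
      rw [this, map_mul, hMσ, zero_mul]
    intro v
    have hv := LinearMap.congr_fun hz v
    simp only [map_mul, map_sub, map_pow, aeval_X, map_one, Module.End.mul_apply,
      LinearMap.sub_apply, Module.End.one_apply, LinearMap.zero_apply] at hv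
    rw [map_sub, ← sub_eq_zero, ← hv]
    abel
  obtain ⟨v₀, hv₀⟩ : ∃ v, (σ ^ N) v - v ≠ 0 := by
    by_contra! hall
    exact hN1 (LinearMap.ext fun v => sub_eq_zero.1 (hall v))
  refine ⟨_, hv₀, fun v => ?_⟩
  set u := (σ ^ N) v₀ - v₀ with hu
  set w := (σ ^ N) v - v with hw
  have hρu : ρ u ≠ 0 := fun h => hv₀ (hρ (by rw [h, map_zero]))
  obtain ⟨c, hc⟩ := exists_algebraMap_eq_of_pow_card_eq (F := F) (x := ρ w / ρ u)
    (by rw [div_pow, ← h, ← h, hfix, hfix])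
  refine ⟨c, hρ ?_⟩
  rw [map_smul, Algebra.smul_def, hc, div_mul_cancel₀ _ hρu]

end FrobeniusPower

/-! ### The polynomial `L` -/

section QPoly

variable {F : Type*} [Field F] [Fintype F]

theorem map_linearized {K K' : Type*} [Field K] [Field K'] (q : ℕ) (f : K →+* K') (P : K[X]) :
    (linearized q P).map f = linearized q (P.map f) := by
  induction P using Polynomial.induction_on' with
  | add P Q hP hQ => simp [hP, hQ]
  | monomial i a =>
    rw [map_monomial, ← C_mul_X_pow_eq_monomial, ← C_mul_X_pow_eq_monomial, linearized_C_mul_X_pow,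
      linearized_C_mul_X_pow]
    simp

theorem qAssociate_eq_linearized (M : F[X]) : qAssociate M = linearized (Fintype.card F) M :=
  (linearized_eq_sum _ _).symm

theorem qPoly_eq_linearized (m : ℕ) (M : F[X]) :
    qPoly m M = linearized (Fintype.card F)
      (M.map (algebraMap F (RatFunc F)) + C (RatFunc.X : RatFunc F) * X ^ m) := by
  rw [qPoly, qAssociate_eq_linearized, map_linearized, map_add, linearized_C_mul_X_pow]

/-- The polynomial `L / x`, with coefficients in `F[t]`. -/
noncomputable def integralQuotient (m : ℕ) (M : F[X]) : F[X][X] :=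
  (divX (qAssociate M)).map C + C X * X ^ (Fintype.card F ^ m - 1)

theorem coeff_zero_qAssociate (M : F[X]) : (qAssociate M).coeff 0 = 0 := by
  rw [qAssociate_eq_linearized, coeff_zero_eq_eval_zero, eval_linearized, Polynomial.sum]
  exact Finset.sum_eq_zero fun i _ => by
    rw [zero_pow (pow_ne_zero _ Fintype.card_ne_zero), mul_zero]

theorem X_mul_integralQuotient (m : ℕ) (M : F[X]) :
    X * integralQuotient m M = (qAssociate M).map C + C X * X ^ Fintype.card F ^ m := by
  have h1 : X * divX (qAssociate M) = qAssociate M := by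
    have := X_mul_divX_add (qAssociate M)
    rwa [coeff_zero_qAssociate, C_0, add_zero] at this
  have h2 : Fintype.card F ^ m - 1 + 1 = Fintype.card F ^ m :=
    Nat.sub_add_cancel (Nat.one_le_pow _ _ Fintype.card_pos)
  have h3 : X * (divX (qAssociate M)).map C = (qAssociate M).map (C : F →+* F[X]) := by
    rw [← map_X (C : F →+* F[X]), ← Polynomial.map_mul, h1]
  rw [integralQuotient, mul_add, h3]
  nth_rw 2 [← h2]
  ring

theorem map_X_mul_integralQuotient (m : ℕ) (M : F[X]) :
    (X * integralQuotient m M).map (algebraMap F[X] (RatFunc F)) = qPoly m M := by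
  rw [X_mul_integralQuotient, qPoly, Polynomial.map_add, Polynomial.map_map, Polynomial.map_mul,
    Polynomial.map_pow, map_X, map_C, RatFunc.algebraMap_X]
  rfl

theorem monic_X_mul_integralQuotient {m : ℕ} (hm : m ≠ 0) {M : F[X]} (hM : M.Monic)
    (hdeg : M.natDegree = 2 * m) : (X * integralQuotient m M).Monic := by
  have hq : 1 < Fintype.card F := Fintype.one_lt_card
  have hnat : (qAssociate M).natDegree = Fintype.card F ^ (2 * m) := by
    rw [qAssociate_eq_linearized, natDegree_linearized hq hM.ne_zero, hdeg]
  have hmon : (qAssociate M).Monic := by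
    rw [Monic, leadingCoeff, hnat, qAssociate_eq_linearized, coeff_linearized hq, ← hdeg]
    exact hM
  rw [X_mul_integralQuotient]
  refine (hmon.map C).add_of_left ?_
  refine (degree_C_mul_X_pow_le _ _).trans_lt ?_
  rw [degree_map_eq_of_injective C_injective, degree_eq_natDegree hmon.ne_zero, hnat]
  exact_mod_cast Nat.pow_lt_pow_right hq (by lia)

/-- `L / x` is irreducible over `F(t)`: it is linear in `t` with coprime coefficients, so Gauss's
lemma applies. -/
theorem irreducible_map_integralQuotient {m : ℕ} (hm : m ≠ 0) {M : F[X]} (hM : M.Monic)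
    (hdeg : M.natDegree = 2 * m) (h0 : M.coeff 0 ≠ 0) :
    Irreducible ((integralQuotient m M).map (algebraMap F[X] (RatFunc F))) := by
  have hmon : (integralQuotient m M).Monic :=
    monic_X.of_mul_monic_left (monic_X_mul_integralQuotient hm hM hdeg)
  rw [← hmon.isPrimitive.irreducible_iff_irreducible_map_fraction_map,
    ← MulEquiv.irreducible_iff (Bivariate.swap (R := F))]
  have hswap : Bivariate.swap (integralQuotient m M) =
      C (X ^ (Fintype.card F ^ m - 1)) * X + C (divX (qAssociate M)) := by
    rw [integralQuotient, map_add, map_mul, map_pow, Bivariate.swap_map_C, Bivariate.swap_X,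
      Bivariate.swap_Y, C_pow, mul_comm, add_comm]
  rw [hswap]
  refine irreducible_C_mul_X_add_C (pow_ne_zero _ X_ne_zero) (IsCoprime.isRelPrime ?_)
  refine IsCoprime.pow_left (irreducible_X.coprime_iff_not_dvd.2 fun h => h0 ?_)
  rw [X_dvd_iff, coeff_divX, zero_add, qAssociate_eq_linearized] at h
  have := coeff_linearized (q := Fintype.card F) Fintype.one_lt_card M 0
  rw [pow_zero] at this
  rw [← this, h]

theorem cast_card_eq_zero (K : Type*) [Field K] [Algebra F K] : (Fintype.card F : K) = 0 := by
  rw [← map_natCast (algebraMap F K), FiniteField.cast_card_eq_zero, map_zero]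

end QPoly

/-! ### The space of roots -/

section Roots

variable {F : Type*} [Field F] [Fintype F] {m : ℕ} {M : F[X]}

theorem mem_rootSpace_iff (hdeg : M.natDegree = 2 * m) (x : (qPoly m M).SplittingField) :
    x ∈ rootSpace m M ↔ ∑ i ∈ Finset.range (2 * m + 1), M.coeff i • x ^ Fintype.card F ^ i +
      algebraMap (RatFunc F) _ RatFunc.X * x ^ Fintype.card F ^ m = 0 := by
  change aeval x (qPoly m M) = 0 ↔ _
  rw [aeval_qPoly, sum_over_range (f := fun i c => c • (FiniteField.frobeniusAlgHom F _ ^ i) x) M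
    (fun _ => zero_smul F _), hdeg, Algebra.smul_def]
  simp only [frobeniusAlgHom_pow_apply]

theorem natDegree_map_add_twist {F : Type*} [Field F] {m : ℕ} {M : F[X]} (hm : m ≠ 0)
    (hM : M.Monic) (hdeg : M.natDegree = 2 * m) :
    (M.map (algebraMap F (RatFunc F)) + C (RatFunc.X : RatFunc F) * X ^ m).natDegree = 2 * m := by
  rw [natDegree_add_eq_left_of_degree_lt, natDegree_map, hdeg]
  refine (degree_C_mul_X_pow_le _ _).trans_lt ?_
  rw [degree_map, degree_eq_natDegree hM.ne_zero, hdeg]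
  exact_mod_cast (by lia)

theorem separable_qPoly (hm : m ≠ 0) (h0 : M.coeff 0 ≠ 0) : (qPoly m M).Separable := by
  rw [qPoly_eq_linearized]
  refine separable_linearized (cast_card_eq_zero (F := F) _) ?_
  rw [coeff_add, coeff_map, coeff_C_mul, coeff_X_pow, if_neg hm.symm, mul_zero, add_zero]
  exact (_root_.map_ne_zero _).2 h0

theorem natDegree_qPoly (hm : m ≠ 0) (hM : M.Monic) (hdeg : M.natDegree = 2 * m) :
    (qPoly m M).natDegree = Fintype.card F ^ (2 * m) := by
  have := natDegree_map_add_twist hm hM hdeg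
  rw [qPoly_eq_linearized, natDegree_linearized Fintype.one_lt_card _, this]
  rintro h
  rw [h, natDegree_zero] at this
  lia

theorem ncard_rootSpace (hm : m ≠ 0) (hM : M.Monic) (hdeg : M.natDegree = 2 * m)
    (h0 : M.coeff 0 ≠ 0) :
    (rootSpace m M : Set (qPoly m M).SplittingField).ncard = Fintype.card F ^ (2 * m) := by
  have hL : qPoly m M ≠ 0 := (separable_qPoly hm h0).ne_zero
  have hset : (rootSpace m M : Set (qPoly m M).SplittingField) =
      (qPoly m M).rootSet (qPoly m M).SplittingField := by
    ext x
    rw [mem_rootSet]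
    exact ⟨fun h => ⟨hL, h⟩, fun h => h.2⟩
  rw [hset, ← natDegree_qPoly hm hM hdeg, ← Nat.card_coe_set_eq, Nat.card_eq_fintype_card]
  exact card_rootSet_eq_natDegree (separable_qPoly hm h0) (SplittingField.splits _)

theorem finite_rootSpace (hm : m ≠ 0) (hM : M.Monic) (hdeg : M.natDegree = 2 * m)
    (h0 : M.coeff 0 ≠ 0) : Finite (rootSpace m M) :=
  Set.finite_of_ncard_ne_zero (s := (rootSpace m M : Set (qPoly m M).SplittingField))
    (by rw [ncard_rootSpace hm hM hdeg h0]; exact pow_ne_zero _ Fintype.card_ne_zero)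

theorem finrank_rootSpace (hm : m ≠ 0) (hM : M.Monic) (hdeg : M.natDegree = 2 * m)
    (h0 : M.coeff 0 ≠ 0) : Module.finrank F (rootSpace m M) = 2 * m := by
  have := finite_rootSpace hm hM hdeg h0
  have h := Module.natCard_eq_pow_finrank (K := F) (V := rootSpace m M)
  rw [show Nat.card (rootSpace m M) = _ from ncard_rootSpace hm hM hdeg h0,
    Nat.card_eq_fintype_card] at h
  exact (Nat.pow_right_injective (Fintype.one_lt_card (α := F)) h).symm

/-- The Galois group acts faithfully, the splitting field being generated by the roots. -/
theorem galRep_injective : Function.Injective (galRep m M) := by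
  intro g h hgh
  refine Gal.ext _ fun x hx => ?_
  have hx' : x ∈ rootSpace m M := by
    rw [mem_rootSet] at hx
    exact hx.2
  exact congrArg Subtype.val (LinearEquiv.congr_fun hgh ⟨x, hx'⟩)

/-- The Galois group is transitive on the nonzero roots, which are the roots of the irreducible
polynomial `L / x`. -/
theorem exists_galRep_apply_eq (hm : m ≠ 0) (hM : M.Monic) (hdeg : M.natDegree = 2 * m)
    (h0 : M.coeff 0 ≠ 0) {x y : rootSpace m M} (hx : x ≠ 0) (hy : y ≠ 0) :
    ∃ g, galRep m M g x = y := by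
  set R := (integralQuotient m M).map (algebraMap F[X] (RatFunc F)) with hR
  have hirr : Irreducible R := irreducible_map_integralQuotient hm hM hdeg h0
  have hroot : ∀ z : rootSpace m M, z ≠ 0 → aeval (z : (qPoly m M).SplittingField) R = 0 := by
    intro z hz
    have h1 : aeval (z : (qPoly m M).SplittingField) (X * R) = 0 := by
      have h2 : X * R = qPoly m M := by
        rw [← map_X_mul_integralQuotient, Polynomial.map_mul, map_X]
      have h3 : ∀ P : (RatFunc F)[X], P = qPoly m M →
          aeval (z : (qPoly m M).SplittingField) P = 0 := by
        rintro P rfl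
        exact z.2
      exact h3 _ h2
    rw [map_mul, aeval_X] at h1
    exact (mul_eq_zero.1 h1).resolve_left fun h => hz (Subtype.ext h)
  have hconj : IsConjRoot (RatFunc F) (y : (qPoly m M).SplittingField) x := by
    rw [isConjRoot_def, ← minpoly.eq_of_irreducible hirr (hroot y hy),
      ← minpoly.eq_of_irreducible hirr (hroot x hx)]
  obtain ⟨g, hg⟩ := hconj.exists_algEquiv
  exact ⟨g, Subtype.ext hg⟩

end Roots

/-! ### The Frobenius element at `t = 0` -/

section Reduction

variable {F : Type*} [Field F] [Fintype F]

/-- In a Galois extension `E` of `F(t)` there is an automorphism that reduces to the `q`-Frobenius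
modulo a prime above `t = 0` of the integral closure of `F[t]`. -/
theorem exists_frobenius_reduction (E : Type*) [Field E] [Algebra (RatFunc F) E] [Algebra F[X] E]
    [IsScalarTower F[X] (RatFunc F) E] [FiniteDimensional (RatFunc F) E] [IsGalois (RatFunc F) E] :
    ∃ (σ : Gal(E/RatFunc F)) (Q : Ideal (integralClosure F[X] E)), Q.IsMaximal ∧
      algebraMap F[X] (integralClosure F[X] E) X ∈ Q ∧
      ∀ b b' : integralClosure F[X] E, (b' : E) = σ b → b' - b ^ Fintype.card F ∈ Q := by
  let B := integralClosure F[X] E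
  have : IsFractionRing B E := integralClosure.isFractionRing_of_finite_extension (RatFunc F) E
  have : Module.Finite F[X] B := IsIntegralClosure.finite F[X] (RatFunc F) E B
  have hinv : Algebra.IsInvariant F[X] B (B ≃ₐ[F[X]] B) :=
    Algebra.isInvariant_of_isGalois' F[X] (RatFunc F) E B
  have : Finite (B ≃ₐ[F[X]] B) :=
    Finite.of_equiv _ (galRestrict F[X] (RatFunc F) E B).toEquiv
  have hmax : (Ideal.span {(X : F[X])}).IsMaximal :=
    PrincipalIdealRing.isMaximal_of_irreducible irreducible_X
  have hker : RingHom.ker (algebraMap F[X] B) ≤ Ideal.span {X} := by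
    intro p hp
    have hpE : algebraMap F[X] E p = 0 := congrArg Subtype.val hp
    rw [IsScalarTower.algebraMap_apply F[X] (RatFunc F) E] at hpE
    have hp' : algebraMap F[X] (RatFunc F) p = 0 :=
      (algebraMap (RatFunc F) E).injective (hpE.trans (map_zero _).symm)
    rw [IsFractionRing.injective F[X] (RatFunc F) (hp'.trans (map_zero _).symm)]
    exact zero_mem _
  obtain ⟨Q, hQ, hQX⟩ := Ideal.exists_ideal_over_maximal_of_isIntegral (S := B) _ hker
  have hcard : Nat.card (F[X] ⧸ Q.under F[X]) = Fintype.card F := by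
    rw [show Q.under F[X] = Ideal.span {X - C 0} by rw [C_0, sub_zero]; exact hQX,
      Nat.card_congr (quotientSpanXSubCAlgEquiv (0 : F)).toEquiv, Nat.card_eq_fintype_card]
  have : Finite (F[X] ⧸ Q.under F[X]) := Nat.finite_of_card_ne_zero (by
    rw [hcard]; exact Fintype.card_ne_zero)
  have : Finite (B ⧸ Q) := Module.finite_of_finite (F[X] ⧸ Q.under F[X])
  obtain ⟨s, hs⟩ := IsArithFrobAt.exists_of_isInvariant F[X] (B ≃ₐ[F[X]] B) Q
  refine ⟨(galRestrict F[X] (RatFunc F) E B).symm s, Q, hQ, ?_, fun b b' hb => ?_⟩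
  · rw [← Ideal.mem_comap, hQX]
    exact Ideal.mem_span_singleton_self X
  · have h1 := hs b
    rw [hcard] at h1
    have h2 : b' = s b := by
      refine Subtype.ext (hb.trans ?_)
      have := algebraMap_galRestrict_apply (A := F[X]) (K := RatFunc F) (L := E) (B := B)
        ((galRestrict F[X] (RatFunc F) E B).symm s) b
      rw [MulEquiv.apply_symm_apply] at this
      exact this.symm
    rw [h2]
    exact h1

end Reduction

section RootReduction

universe u

variable {F : Type u} [Field F] [Fintype F] {m : ℕ} {M : F[X]}

theorem isIntegral_of_mem_rootSpace (hm : m ≠ 0) (hM : M.Monic) (hdeg : M.natDegree = 2 * m)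
    {x : (qPoly m M).SplittingField} (hx : x ∈ rootSpace m M) : IsIntegral F[X] x := by
  refine ⟨_, monic_X_mul_integralQuotient hm hM hdeg, ?_⟩
  have h : aeval x (qPoly m M) = 0 := hx
  have h3 : ∀ P : (RatFunc F)[X], P = qPoly m M → aeval x P = 0 := by
    rintro P rfl
    exact h
  have h4 := h3 _ (map_X_mul_integralQuotient m M)
  rwa [aeval_map_algebraMap] at h4

/-- The constants `F` inside `F[t]` act on the splitting field as `F` itself. -/
theorem algebraMap_C_eq (a : F) : algebraMap F[X] (qPoly m M).SplittingField (C a) =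
    algebraMap F (qPoly m M).SplittingField a := by
  rw [IsScalarTower.algebraMap_apply F[X] (RatFunc F), IsScalarTower.algebraMap_apply F (RatFunc F),
    IsScalarTower.algebraMap_apply F F[X] (RatFunc F), algebraMap_eq]

/-- Some element of the Galois group acts on the roots as the `q`-Frobenius acts on the zeros of the
`q`-associate `Φ` of `M`: reduction modulo a prime above `t = 0` is injective on the roots, because
the coefficient of `x` in `L` is a unit. -/
theorem exists_galRep_frobenius (hm : m ≠ 0) (hM : M.Monic) (hdeg : M.natDegree = 2 * m)
    (h0 : M.coeff 0 ≠ 0) :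
    ∃ (g : (qPoly m M).Gal) (k : Type u) (_ : Field k) (_ : Algebra F k)
      (ρ : rootSpace m M →ₗ[F] k),
      Function.Injective ρ ∧ (∀ v, ρ (galRep m M g v) = ρ v ^ Fintype.card F) ∧
      ∀ v, (linearized (Fintype.card F) (M.map (algebraMap F k))).eval (ρ v) = 0 := by
  have : IsGalois (RatFunc F) (qPoly m M).SplittingField :=
    IsGalois.of_separable_splitting_field (separable_qPoly hm h0)
  obtain ⟨g, Q, hQ, hXQ, hfrob⟩ := exists_frobenius_reduction (F := F) (qPoly m M).SplittingField
  let B := integralClosure F[X] (qPoly m M).SplittingField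
  let _ : Field (B ⧸ Q) := Ideal.Quotient.field Q
  -- the constants of `F[t]` make the residue field an extension of `F`
  let _ : Algebra F (B ⧸ Q) :=
    ((Ideal.Quotient.mk Q).comp ((algebraMap F[X] B).comp C)).toAlgebra
  let ι : rootSpace m M → B := fun v => ⟨v, isIntegral_of_mem_rootSpace hm hM hdeg v.2⟩
  let ρ : rootSpace m M →ₗ[F] B ⧸ Q :=
    { toFun := fun v => Ideal.Quotient.mk Q (ι v)
      map_add' := fun v w => by
        rw [← map_add]; rfl
      map_smul' := fun a v => by
        rw [Algebra.smul_def, RingHom.id_apply]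
        change _ = Ideal.Quotient.mk Q (algebraMap F[X] B (C a)) * _
        rw [← map_mul]
        congr 1
        refine Subtype.ext ?_
        change a • (v : (qPoly m M).SplittingField) = algebraMap F[X] _ (C a) * v
        rw [algebraMap_C_eq, Algebra.smul_def] }
  have hint : ∀ v : rootSpace m M,
      ∑ i ∈ Finset.range (2 * m + 1), algebraMap F[X] B (C (M.coeff i)) * ι v ^ Fintype.card F ^ i +
        algebraMap F[X] B X * ι v ^ Fintype.card F ^ m = 0 := by
    intro v
    refine Subtype.ext ?_
    have h := (mem_rootSpace_iff hdeg _).1 v.2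
    simp only [Algebra.smul_def, ← algebraMap_C_eq] at h
    rw [← RatFunc.algebraMap_X, ← IsScalarTower.algebraMap_apply] at h
    simpa using h
  refine ⟨g, B ⧸ Q, inferInstance, inferInstance, ρ, ?_, ?_, ?_⟩
  · rw [injective_iff_map_eq_zero]
    intro v hv
    by_contra hv0
    have hq : 1 < Fintype.card F := Fintype.one_lt_card
    have hιQ : ι v ∈ Q := Ideal.Quotient.eq_zero_iff_mem.1 hv
    have hι0 : ι v ≠ 0 := fun h =>
      hv0 (Subtype.ext (show (v : (qPoly m M).SplittingField) = 0 from congrArg Subtype.val h))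
    -- divide the equation of `v` by `v`
    have hdiv : ι v * (∑ i ∈ Finset.range (2 * m), algebraMap F[X] B (C (M.coeff (i + 1))) *
        ι v ^ (Fintype.card F ^ (i + 1) - 1) + algebraMap F[X] B (C (M.coeff 0)) +
          algebraMap F[X] B X * ι v ^ (Fintype.card F ^ m - 1)) = 0 := by
      have hpow : ∀ n : ℕ, ι v * ι v ^ (Fintype.card F ^ n - 1) = ι v ^ Fintype.card F ^ n :=
        fun n => mul_pow_sub_one (pow_ne_zero _ (by lia)) _
      rw [← hint v, Finset.sum_range_succ', mul_add, mul_add, Finset.mul_sum]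
      simp only [mul_left_comm (ι v), hpow, pow_zero, pow_one]
      rw [mul_comm (ι v)]
    have hsum := (mul_eq_zero.1 hdiv).resolve_left hι0
    have hpowQ : ∀ n : ℕ, n ≠ 0 → ι v ^ (Fintype.card F ^ n - 1) ∈ Q := fun n hn =>
      Ideal.pow_mem_of_mem _ hιQ _ (Nat.sub_pos_of_lt (Nat.one_lt_pow hn hq))
    have hcQ : algebraMap F[X] B (C (M.coeff 0)) ∈ Q := by
      have h1 : ∑ i ∈ Finset.range (2 * m), algebraMap F[X] B (C (M.coeff (i + 1))) *
          ι v ^ (Fintype.card F ^ (i + 1) - 1) ∈ Q :=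
        Q.sum_mem fun i _ => Q.mul_mem_left _ (hpowQ _ (Nat.succ_ne_zero i))
      have h2 : algebraMap F[X] B X * ι v ^ (Fintype.card F ^ m - 1) ∈ Q :=
        Q.mul_mem_left _ (hpowQ m hm)
      have h3 := Q.neg_mem (Q.add_mem h1 h2)
      convert! h3 using 1
      linear_combination hsum
    refine hQ.ne_top (Ideal.eq_top_of_isUnit_mem _ hcQ ?_)
    exact ((h0.isUnit.map C).map (algebraMap F[X] B))
  · intro v
    change Ideal.Quotient.mk Q _ = Ideal.Quotient.mk Q _ ^ _
    rw [← map_pow, Ideal.Quotient.eq]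
    exact hfrob _ _ rfl
  · intro v
    rw [eval_linearized, sum_over_range' _ (fun _ => zero_mul _) (2 * m + 1)
      (Nat.lt_succ_of_le (natDegree_map_le.trans hdeg.le))]
    have h := congrArg (Ideal.Quotient.mk Q) (hint v)
    rw [map_add, map_mul, Ideal.Quotient.eq_zero_iff_mem.2 hXQ, zero_mul, add_zero, map_sum,
      map_zero] at h
    rw [← h]
    refine Finset.sum_congr rfl fun i _ => ?_
    rw [coeff_map, map_mul, map_pow]
    rfl

end RootReduction

/-! ### The Galois group -/

section Main

variable {F : Type*} [Field F] [Fintype F] {m : ℕ} {M : F[X]}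

/-- A self-reciprocal polynomial with constant term one has symmetric coefficients. -/
theorem IsSelfReciprocal.coeff_sub {F : Type*} [Field F] {M : F[X]} {n : ℕ}
    (hrec : IsSelfReciprocal M)
    (h0 : M.eval 0 = 1) (hdeg : M.natDegree = n) {i : ℕ} (hi : i ≤ n) :
    M.coeff (n - i) = M.coeff i := by
  have h : M = M.reverse := by
    have := hrec.2
    rwa [h0, inv_one, C_1, one_mul] at this
  rw [h, coeff_reverse, hdeg, revAt_le (Nat.sub_le _ _), ← h, Nat.sub_sub_self hi]

/-- The Galois group contains an element different from one that is the identity up to a map of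
rank one. -/
theorem exists_galRep_rank_one (hm : m ≠ 0) (hM : M.Monic) (hdeg : M.natDegree = 2 * m)
    {M₁ : F[X]} (hM₁ : M = (X - C 1) ^ 2 * M₁) (hsq : Squarefree M₁) (h0 : M₁.eval 0 ≠ 0)
    (hsub : ¬ (X - C 1) ∣ M₁) :
    ∃ g, galRep m M g ≠ 1 ∧ ∃ u : rootSpace m M, u ≠ 0 ∧ ∀ v, ∃ c : F,
      galRep m M g v - v = c • u := by
  have hM0 : M.coeff 0 ≠ 0 := by
    rw [coeff_zero_eq_eval_zero, hM₁]
    simpa using h0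
  obtain ⟨g, k, _, _, ρ, hρ, hfrob, hzero⟩ := exists_galRep_frobenius hm hM hdeg hM0
  set σ : rootSpace m M →ₗ[F] rootSpace m M := (galRep m M g).toLinearMap with hσ
  have hMσ : aeval σ M = 0 := by
    ext1 v
    apply hρ
    rw [apply_aeval_eq_eval_linearized (σ := σ) hfrob, hzero, LinearMap.zero_apply, map_zero]
  obtain ⟨N, hN, u, hu, hur⟩ := exists_pow_sub_one_rank_one hρ hfrob hM
    (by rw [hdeg]; exact (ncard_rootSpace hm hM hdeg hM0).ge) hMσ hM₁ hsq h0 hsub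
  have hpow : (galRep m M (g ^ N)).toLinearMap = σ ^ N := by
    rw [map_pow]
    exact map_pow (LinearEquiv.automorphismGroup.toLinearMapMonoidHom) (galRep m M g) N
  refine ⟨g ^ N, fun h => hN ?_, u, hu, fun v => ?_⟩
  · rw [← hpow, h]; rfl
  · obtain ⟨c, hc⟩ := hur v
    exact ⟨c, by rw [← hc, ← hpow]; rfl⟩

theorem exists_invariant_form (hm : m ≠ 0) (hM : M.Monic) (hdeg : M.natDegree = 2 * m)
    (hrec : IsSelfReciprocal M) (h0 : M.eval 0 = 1) :
    ∃ B : LinearMap.BilinForm F (rootSpace m M), B.IsAlt ∧ B.Nondegenerate ∧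
      (galRep m M).range ≤ isometryGroup B := by
  have hM0 : M.coeff 0 ≠ 0 := by rw [coeff_zero_eq_eval_zero, h0]; exact one_ne_zero
  obtain ⟨B, hB, hnd, hform⟩ := exists_alternating_form hm (c := M.coeff)
    (fun i hi => hrec.coeff_sub h0 hdeg hi)
    (by rw [← hdeg]; exact leadingCoeff_ne_zero.2 hM.ne_zero) (rootSpace m M)
    (fun x hx => (mem_rootSpace_iff hdeg x).1 hx) (ncard_rootSpace hm hM hdeg hM0).ge
  refine ⟨B, hB, hnd, ?_⟩
  rintro _ ⟨g, rfl⟩ x y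
  apply (algebraMap F (qPoly m M).SplittingField).injective
  have hg := map_twistedForm m M.coeff ((AlgEquiv.restrictScalars F g).toAlgHom)
    (x : (qPoly m M).SplittingField) (y : (qPoly m M).SplittingField)
  rw [← hform, AlgHom.commutes] at hg
  rw [hform, hg]
  rfl

end Main

end SymplecticGalois

open SymplecticGalois in
theorem mainTheorem1 {F : Type*} [Field F] [Fintype F] (m : ℕ) (M M₁ : F[X])
    (hmonic : M.Monic) (hdeg : M.natDegree = 2 * m)
    (hrec : SymplecticGalois.IsSelfReciprocal M) (h0 : M.eval 0 = 1)
    (hmult : M.rootMultiplicity 1 = 2) (hM₁ : M = (X - C 1) ^ 2 * M₁)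
    (hsq : Squarefree M₁) (hsub : ¬ (X - C 1) ∣ M₁) (hadd : ¬ (X + C 1) ∣ M₁) :
    Module.finrank F (SymplecticGalois.rootSpace m M) = 2 * m ∧
    (∃ B : LinearMap.BilinForm F (SymplecticGalois.rootSpace m M),
      B.IsAlt ∧ B.Nondegenerate ∧
      Function.Injective (SymplecticGalois.galRep m M) ∧
      (SymplecticGalois.galRep m M).range = SymplecticGalois.isometryGroup B) ∧
    Nonempty ((SymplecticGalois.qPoly m M).Gal ≃* Matrix.symplecticGroup (Fin m) F) := by
  have hm : m ≠ 0 := by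
    rintro rfl
    rw [eq_one_of_monic_natDegree_zero hmonic (by simpa using hdeg),
      rootMultiplicity_eq_zero] at hmult
    · exact two_ne_zero hmult.symm
    · simp
  have hM0 : M.coeff 0 ≠ 0 := by rw [coeff_zero_eq_eval_zero, h0]; exact one_ne_zero
  have hM₁0 : M₁.eval 0 ≠ 0 := by
    intro h
    rw [hM₁, eval_mul, h, mul_zero] at h0
    exact zero_ne_one h0
  have hfin := finite_rootSpace hm hmonic hdeg hM0
  have hrank := finrank_rootSpace hm hmonic hdeg hM0
  have hinj : Function.Injective (galRep m M) := galRep_injective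
  obtain ⟨B, hB, hnd, hle⟩ := exists_invariant_form hm hmonic hdeg hrec h0
  obtain ⟨g, hg1, u, hu, hgu⟩ := exists_galRep_rank_one hm hmonic hdeg hM₁ hsq hM₁0 hsub
  obtain ⟨a, ha, hga⟩ := exists_eq_sympTransvection hB hnd (hle ⟨g, rfl⟩) hg1 hgu
  have hrange : (galRep m M).range = isometryGroup B := by
    refine eq_isometryGroup_of_transitive hB hnd hle (fun x y hx hy => ?_) ha hu ⟨g, hga⟩
    obtain ⟨s, hs⟩ := exists_galRep_apply_eq hm hmonic hdeg hM0 hx hy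
    exact ⟨_, ⟨s, rfl⟩, hs⟩
  refine ⟨hrank, ⟨B, hB, hnd, hinj, hrange⟩, ?_⟩
  obtain ⟨e⟩ := nonempty_isometryGroup_mulEquiv hB hnd hrank
  exact ⟨(MonoidHom.ofInjective hinj).trans ((MulEquiv.subgroupCongr hrange).trans e)⟩
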